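/- Let $\mathcal X\subseteq\mathbb R^d$ be a data space with the metric induced by the max norm $\|\cdot\|$, let $P$ be a probability distribution on $\mathcal X$, let $h$ be a fixed model, and let $x\mapsto f(h,x)$ be a nonnegative, bounded, measurable loss on $\mathcal X$ with $C=\sup_{x\in\mathcal X} f(h,x)$. Let $\boldsymbol D=(s_1,\dots,s_m)$, $m\ge 1$, be i.i.d. samples from $P$, and let $\mathcal X=\bigcup_{i=1}^N\mathcal X_i$ be a partition into $N$ disjoint nonempty measurable subsets. Let $\boldsymbol D_i$ be the family of samples that fall into $\mathcal X_i$ (counted with multiplicity), $m_i=|\boldsymbol D_i|$, and $\boldsymbol T=\{i\in[N]: m_i>0\}$. For $i\in\boldsymbol T$ put $$\lambda_i=\frac1{m_i}\sum_{s\in \boldsymbol D_i}\mathbb E_{x\sim P}\big[\|x-s\| \,\big|\, x\in\mathcal X_i\big]\in[0,\infty].$$ Put $F(P,h)=\mathbb E_{x\sim P}[f(h,x)]$ and $F(\boldsymbol D,h)=\frac1m\sum_{j=1}^m f(h,s_j)$, and for $\delta>0$ $$g(\boldsymbol D,\delta)=C(\sqrt2+1)\sqrt{\frac{|\boldsymbol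 T|\ln(2N/\delta)}{m}}+\frac{2C|\boldsymbol T|\ln(2N/\delta)}{m}.$$ Then for every $\delta>0$, with probability at least $1-\delta$ over $\boldsymbol D$ the following holds: for all $L_1,\dots,L_N\ge 0$ such that $f(h,\cdot)$ is $L_i$-Lipschitz continuous on $\mathcal X_i$ for every $i\in\boldsymbol T$, $$F(P,h)\le F(\boldsymbol D,h)+\sum_{i\in\boldsymbol T}\frac{m_i}{m}\lambda_iL_i+g(\boldsymbol D,\delta),$$ with the convention $\infty\cdot 0=0$. -/

import Mathlib

open MeasureTheory ProbabilityTheory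
open scoped ENNReal NNReal

namespace LocalLipschitz

/-- The sets `A i`, `i ∈ [N]`, form a (measurable) partition of the data space `𝒳`
into `N` disjoint nonempty subsets. -/
structure IsCellPartition {d N : ℕ} {𝒳 : Set (Fin d → ℝ)} (A : Fin N → Set 𝒳) : Prop where
  measurableSet : ∀ i, MeasurableSet (A i)
  nonempty : ∀ i, (A i).Nonempty
  disjoint : Pairwise fun i j => Disjoint (A i) (A j)
  iUnion_eq : ⋃ i, A i = Set.univ

section

variable {d m N : ℕ} {𝒳 : Set (Fin d → ℝ)} {H : Type*}

/-- Expected loss `F(P, h) = E_{x ∼ P} f(h, x)`. -/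
noncomputable def expectedLoss (P : Measure 𝒳) (f : H → 𝒳 → ℝ) (h : H) : ℝ :=
  ∫ x, f h x ∂P

/-- Empirical loss `F(D, h) = (1/m) ∑_{s ∈ D} f(h, s)`. -/
noncomputable def empiricalLoss (D : Fin m → 𝒳) (f : H → 𝒳 → ℝ) (h : H) : ℝ :=
  (1 / (m : ℝ)) * ∑ j, f h (D j)

open Classical in
/-- The indices of the samples of `D` that fall into the cell `A i`
(so that samples are counted with multiplicity). -/
noncomputable def samplesIn (A : Fin N → Set 𝒳) (D : Fin m → 𝒳) (i : Fin N) : Finset (Fin m) :=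
  Finset.univ.filter fun j => D j ∈ A i

/-- `m_i`, the number of samples that fall into the cell `A i`. -/
noncomputable def cellCount (A : Fin N → Set 𝒳) (D : Fin m → 𝒳) (i : Fin N) : ℕ :=
  (samplesIn A D i).card

/-- `T = {i ∈ [N] : m_i > 0}`. -/
noncomputable def occupied (A : Fin N → Set 𝒳) (D : Fin m → 𝒳) : Finset (Fin N) :=
  Finset.univ.filter fun i => 0 < cellCount A D i

/-- `λ_i = (1/m_i) ∑_{s ∈ D_i} E_{x ∼ P}[‖x - s‖ : x ∈ A i]`, where `‖·‖` is the max norm and the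
expectation is conditional on the cell. It takes values in `[0, ∞]`, so that no moment assumption
on `P` is needed. -/
noncomputable def avgDist (P : Measure 𝒳) (A : Fin N → Set 𝒳) (D : Fin m → 𝒳) (i : Fin N) :
    ℝ≥0∞ :=
  (cellCount A D i : ℝ≥0∞)⁻¹ *
    ∑ j ∈ samplesIn A D i, ∫⁻ x, ‖(x : Fin d → ℝ) - (D j : Fin d → ℝ)‖ₑ ∂(P[|A i])

/-- `C = sup_x f(h, x)`. -/
noncomputable def supLoss (f : H → 𝒳 → ℝ) (h : H) : ℝ :=
  ⨆ x, f h x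

/-- `g(D, δ) = C (√2 + 1) √(|T| ln(2N/δ) / m) + 2 C |T| ln(2N/δ) / m`. -/
noncomputable def gTerm (f : H → 𝒳 → ℝ) (h : H) (A : Fin N → Set 𝒳) (D : Fin m → 𝒳) (δ : ℝ) :
    ℝ :=
  supLoss f h * (√2 + 1) * √(((occupied A D).card : ℝ) * Real.log (2 * N / δ) / m) +
    2 * supLoss f h * ((occupied A D).card : ℝ) * Real.log (2 * N / δ) / m

end

end LocalLipschitz

namespace LocalLipschitz

/-! ### Upper tail of the cell counts. -/

section Chernoff

variable {Ω E : Type*} [MeasurableSpace Ω] [MeasurableSpace E] {μ : Measure Ω} {P : Measure E}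

/-! Write `F(P,h) = ∑ pᵢ aᵢ` with `pᵢ` the mass of cell `i` and `aᵢ` its conditional mean loss, and
let `cᵢ = mᵢ/m`. With `l = ln(2N/δ)`, Chernoff and a union bound give `cᵢ ≤ pᵢ + eᵢ` for all cells,
where `eᵢ = 2√(l pᵢ/m) + 2l/m` (`measureReal_sum_indicator_ge_le`). This one-sided bound suffices:
the mass missed by the sample equals the excess `∑_T (cᵢ - pᵢ)`, so replacing `pᵢ` by `cᵢ` costs at
most `C ∑_T eᵢ` (`sum_mul_le_of_weights`). Cauchy–Schwarz turns `∑_T √pᵢ` into `√|T|`. Finally `aᵢ`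
is compared with each sample in its cell by the Lipschitz property and averaged
(`sum_freq_mul_lintegral_cond_le`). -/

lemma mgf_indicator_le [IsProbabilityMeasure P] {s : Set E} (hs : MeasurableSet s) (t : ℝ) :
    mgf (s.indicator fun _ => (1 : ℝ)) P t ≤ Real.exp (P.real s * (Real.exp t - 1)) := by
  have hfun : (fun x => Real.exp (t * s.indicator (fun _ => (1 : ℝ)) x)) =
      fun x => 1 + s.indicator (fun _ => Real.exp t - 1) x := by
    funext x
    by_cases hx : x ∈ s <;> simp [hx]
  have hint : Integrable (s.indicator fun _ => Real.exp t - 1) P :=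
    (integrable_const _).indicator hs
  rw [mgf, hfun, integral_add (integrable_const _) hint, integral_indicator_const _ hs]
  simp only [integral_const, probReal_univ, smul_eq_mul, one_mul]
  linarith [Real.add_one_le_exp (P.real s * (Real.exp t - 1))]

lemma measureReal_sum_indicator_ge_le_exp [IsProbabilityMeasure μ] [IsProbabilityMeasure P] {m : ℕ}
    {D : Fin m → Ω → E} (hD_meas : ∀ j, Measurable (D j)) (hD_indep : iIndepFun D μ)
    (hD_law : ∀ j, μ.map (D j) = P) {s : Set E} (hs : MeasurableSet s) {t : ℝ} (ht : 0 ≤ t)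
    (ε : ℝ) :
    μ.real {ω | ε ≤ ∑ j, s.indicator (fun _ => (1 : ℝ)) (D j ω)} ≤
      Real.exp (-t * ε + m * P.real s * (Real.exp t - 1)) := by
  set Y : E → ℝ := s.indicator fun _ => (1 : ℝ)
  have hY : Measurable Y := measurable_const.indicator hs
  have hX : ∀ j, Measurable (Y ∘ D j) := fun j => hY.comp (hD_meas j)
  have hind : iIndepFun (fun j => Y ∘ D j) μ := hD_indep.comp _ fun _ => hY
  have hY1 : ∀ x, Y x ≤ 1 := fun x => Set.indicator_le_self' (by simp) x
  have hmgf : mgf (∑ j, Y ∘ D j) μ t ≤ Real.exp (m * P.real s * (Real.exp t - 1)) := by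
    rw [hind.mgf_sum hX]
    calc ∏ j, mgf (Y ∘ D j) μ t ≤ ∏ _j : Fin m, Real.exp (P.real s * (Real.exp t - 1)) := by
          refine Finset.prod_le_prod (fun _ _ => mgf_nonneg) fun j _ => ?_
          have hmap := mgf_map (μ := μ) (Y := D j) (X := Y) (t := t) (hD_meas j).aemeasurable
            (by rw [hD_law j]; fun_prop)
          rw [← hmap, hD_law j]
          exact mgf_indicator_le hs t
      _ = _ := by
          rw [Finset.prod_const, ← Real.exp_nat_mul]
          simp [mul_assoc]
  have hint : Integrable (fun ω => Real.exp (t * (∑ j, Y ∘ D j) ω)) μ := by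
    refine Integrable.of_bound (C := Real.exp (t * m)) ?_ (ae_of_all _ fun ω => ?_)
    · have : Measurable (∑ j, Y ∘ D j) := by
        simpa [Finset.sum_fn] using Finset.measurable_sum Finset.univ fun j _ => hX j
      exact (by fun_prop : Measurable _).aestronglyMeasurable
    · rw [Real.norm_eq_abs, Real.abs_exp, Real.exp_le_exp, Finset.sum_apply]
      refine mul_le_mul_of_nonneg_left ?_ ht
      calc ∑ j, (Y ∘ D j) ω ≤ ∑ _j : Fin m, (1 : ℝ) := Finset.sum_le_sum fun j _ => hY1 _
        _ = m := by simp
  have key := measure_ge_le_exp_mul_mgf (μ := μ) ε ht hint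
  simp only [Finset.sum_apply, Function.comp_apply] at key
  rw [Real.exp_add]
  exact key.trans (mul_le_mul_of_nonneg_left hmgf (Real.exp_pos _).le)

/-- The choice is `t = min(1, √(l/q))`, which stays in the range where `exp t - 1 ≤ t + t²`. For `l
< q` it balances `q t² = l` against `t · 2√(ql) = 2l`. -/
lemma exists_chernoff_parameter {q l : ℝ} (hq : 0 ≤ q) (hl : 0 < l) :
    ∃ t : ℝ, 0 ≤ t ∧ -t * (q + 2 * √(q * l) + 2 * l) + q * (Real.exp t - 1) ≤ -l := by
  have hexp : ∀ t : ℝ, 0 ≤ t → t ≤ 1 → q * (Real.exp t - 1) ≤ q * (t + t ^ 2) := by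
    intro t h0 h1
    have := (abs_le.1 (Real.abs_exp_sub_one_sub_id_le (abs_le.2 ⟨by linarith, h1⟩))).2
    exact mul_le_mul_of_nonneg_left (by linarith) hq
  rcases le_or_gt q l with h | h
  · refine ⟨1, zero_le_one, ?_⟩
    have := hexp 1 zero_le_one le_rfl
    have := Real.sqrt_nonneg (q * l)
    linarith
  · have hq' : 0 < q := hl.trans h
    have hsq : 0 < √q := Real.sqrt_pos.2 hq'
    have ht0 : 0 ≤ √l / √q := by positivity
    have ht1 : √l / √q ≤ 1 := (div_le_one hsq).2 (Real.sqrt_le_sqrt h.le)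
    refine ⟨√l / √q, ht0, ?_⟩
    have h1 := hexp _ ht0 ht1
    have h2 : √l / √q * √(q * l) = l := by
      rw [Real.sqrt_mul hq, ← mul_assoc, div_mul_cancel₀ _ hsq.ne', Real.mul_self_sqrt hl.le]
    have h3 : q * (√l / √q) ^ 2 = l := by
      rw [div_pow, Real.sq_sqrt hl.le, Real.sq_sqrt hq, mul_div_cancel₀ _ hq'.ne']
    have h4 : 0 ≤ √l / √q * l := by positivity
    linarith

/-- Upper tail bound for the number of i.i.d. samples falling into `s`. -/
lemma measureReal_sum_indicator_ge_le [IsProbabilityMeasure μ] [IsProbabilityMeasure P] {m : ℕ}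
    {D : Fin m → Ω → E} (hD_meas : ∀ j, Measurable (D j)) (hD_indep : iIndepFun D μ)
    (hD_law : ∀ j, μ.map (D j) = P) {s : Set E} (hs : MeasurableSet s) {l : ℝ} (hl : 0 < l) :
    μ.real {ω | m * P.real s + 2 * √(m * P.real s * l) + 2 * l ≤
      ∑ j, s.indicator (fun _ => (1 : ℝ)) (D j ω)} ≤ Real.exp (-l) := by
  obtain ⟨t, ht, hle⟩ := exists_chernoff_parameter (q := m * P.real s) (by positivity) hl
  exact (measureReal_sum_indicator_ge_le_exp hD_meas hD_indep hD_law hs ht _).trans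
    (Real.exp_le_exp.2 hle)

end Chernoff

/-! ### Bounds for a fixed sample. -/

section Deterministic

variable {d m N : ℕ} {𝒳 : Set (Fin d → ℝ)}

lemma cellCount_eq_sum_indicator (A : Fin N → Set 𝒳) (D : Fin m → 𝒳) (i : Fin N) :
    (cellCount A D i : ℝ) = ∑ j, (A i).indicator (fun _ => (1 : ℝ)) (D j) := by
  classical
  simp [cellCount, samplesIn, Set.indicator_apply]

lemma IsCellPartition.sum_samplesIn {M : Type*} [AddCommMonoid M] {A : Fin N → Set 𝒳}
    (hA : IsCellPartition A) (D : Fin m → 𝒳) (φ : Fin m → M) :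
    ∑ i ∈ occupied A D, ∑ j ∈ samplesIn A D i, φ j = ∑ j, φ j := by
  classical
  have hex : ∀ x : 𝒳, ∃ i, x ∈ A i := fun x => Set.mem_iUnion.1 (hA.iUnion_eq ▸ Set.mem_univ x)
  choose κ hκ using hex
  have hiff : ∀ x i, x ∈ A i ↔ κ x = i := fun x i =>
    ⟨fun hx => by
      by_contra hne
      exact Set.disjoint_left.1 (hA.disjoint hne) (hκ x) hx, fun hx => hx ▸ hκ x⟩
  rw [Finset.sum_subset (Finset.subset_univ _)]
  · simp only [samplesIn, hiff]
    exact Finset.sum_fiberwise _ _ _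
  · intro i _ hi
    have : samplesIn A D i = ∅ := by simpa [occupied, cellCount] using hi
    simp [this]

lemma IsCellPartition.sum_cellCount {A : Fin N → Set 𝒳} (hA : IsCellPartition A)
    (D : Fin m → 𝒳) : ∑ i ∈ occupied A D, cellCount A D i = m := by
  simpa [cellCount] using hA.sum_samplesIn D fun _ => (1 : ℕ)

lemma IsCellPartition.sum_measureReal {A : Fin N → Set 𝒳} (hA : IsCellPartition A)
    (P : Measure 𝒳) [IsProbabilityMeasure P] : ∑ i, P.real (A i) = 1 := by
  rw [← measureReal_iUnion_fintype hA.disjoint hA.measurableSet, hA.iUnion_eq, probReal_univ]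

lemma IsCellPartition.integral_eq_sum_cond {A : Fin N → Set 𝒳} (hA : IsCellPartition A)
    (P : Measure 𝒳) [IsProbabilityMeasure P] {φ : 𝒳 → ℝ} (hφ : Integrable φ P) :
    ∫ x, φ x ∂P = ∑ i, P.real (A i) * ∫ x, φ x ∂P[|A i] := by
  rw [← setIntegral_univ, ← hA.iUnion_eq,
    integral_iUnion_fintype hA.measurableSet hA.disjoint fun i => hφ.integrableOn]
  refine Finset.sum_congr rfl fun i _ => ?_
  rw [ProbabilityTheory.cond, integral_smul_measure, ENNReal.toReal_inv, smul_eq_mul]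
  -- On a null cell the conditional measure is zero, so both sides vanish.
  rcases eq_or_ne (P (A i)) 0 with h0 | h0
  · simp [measureReal_def, h0, Measure.restrict_eq_zero.2 h0]
  · rw [measureReal_def, mul_inv_cancel_left₀ (ENNReal.toReal_ne_zero.2 ⟨h0, measure_ne_top _ _⟩)]

/-- On a cell where the loss is Lipschitz, its conditional mean exceeds its value at a point of the
cell by at most the Lipschitz constant times the mean distance to that point. -/
lemma lintegral_cond_le_of_lipschitzOnWith (P : Measure 𝒳) {φ : 𝒳 → ℝ} {B : Set 𝒳}
    (hB : MeasurableSet B) {L : ℝ≥0} (hL : LipschitzOnWith L φ B) {s : 𝒳} (hs : s ∈ B) :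
    ∫⁻ x, ENNReal.ofReal (φ x) ∂P[|B] ≤ ENNReal.ofReal (φ s) +
      (∫⁻ x, ‖(x : Fin d → ℝ) - (s : Fin d → ℝ)‖ₑ ∂P[|B]) * L := by
  have hpt : ∀ᵐ x ∂P[|B], ENNReal.ofReal (φ x) ≤
      ENNReal.ofReal (φ s) + ‖(x : Fin d → ℝ) - (s : Fin d → ℝ)‖ₑ * L := by
    filter_upwards [ae_cond_mem hB] with x hx
    have h1 : φ x ≤ φ s + L * dist x s := by
      have := hL.dist_le_mul x hx s hs
      rw [Real.dist_eq] at this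
      linarith [le_abs_self (φ x - φ s)]
    have h2 : ENNReal.ofReal (L * dist x s) = ‖(x : Fin d → ℝ) - (s : Fin d → ℝ)‖ₑ * L := by
      rw [ENNReal.ofReal_mul L.coe_nonneg, ENNReal.ofReal_coe_nnreal, mul_comm, Subtype.dist_eq,
        dist_eq_norm, ofReal_norm]
    exact (ENNReal.ofReal_le_ofReal h1).trans (h2 ▸ ENNReal.ofReal_add_le)
  refine (lintegral_mono_ae hpt).trans ?_
  rw [lintegral_add_left measurable_const, lintegral_mul_const _ (by fun_prop), lintegral_const]
  gcongr
  -- The total mass of `P[|B]` is only at most 1: it is 0 when `B` is null.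
  exact mul_le_of_le_one_right' prob_le_one

lemma cellCount_mul_lintegral_cond_le (P : Measure 𝒳) {φ : 𝒳 → ℝ} {A : Fin N → Set 𝒳}
    (hA : IsCellPartition A) (D : Fin m → 𝒳) (i : Fin N) {L : ℝ≥0}
    (hL : LipschitzOnWith L φ (A i)) :
    (cellCount A D i : ℝ≥0∞) * ∫⁻ x, ENNReal.ofReal (φ x) ∂P[|A i] ≤
      ∑ j ∈ samplesIn A D i, ENNReal.ofReal (φ (D j)) +
        cellCount A D i * avgDist P A D i * L := by
  classical
  rcases eq_or_ne (cellCount A D i) 0 with h0 | h0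
  · simp [h0]
  · rw [avgDist, ENNReal.mul_inv_cancel_left (by simpa using h0) (by simp), Finset.sum_mul,
      ← Finset.sum_add_distrib, ← nsmul_eq_mul, cellCount, ← Finset.sum_const]
    refine Finset.sum_le_sum fun j hj => ?_
    exact lintegral_cond_le_of_lipschitzOnWith P (hA.measurableSet i) hL
      (by simpa [samplesIn] using hj)

/-- The means of the loss over the occupied cells, weighted by the sample frequencies, are bounded
by the empirical loss plus the Lipschitz term. -/
lemma sum_freq_mul_lintegral_cond_le (hm : 0 < m) (P : Measure 𝒳) {H : Type*} {f : H → 𝒳 → ℝ}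
    {h : H} (hf : ∀ x, 0 ≤ f h x) {A : Fin N → Set 𝒳} (hA : IsCellPartition A) (D : Fin m → 𝒳)
    {L : Fin N → ℝ≥0} (hL : ∀ i ∈ occupied A D, LipschitzOnWith (L i) (f h) (A i)) :
    ∑ i ∈ occupied A D, (cellCount A D i : ℝ≥0∞) / m * ∫⁻ x, ENNReal.ofReal (f h x) ∂P[|A i] ≤
      ENNReal.ofReal (empiricalLoss D f h) +
        ∑ i ∈ occupied A D, (cellCount A D i : ℝ≥0∞) / m * avgDist P A D i * L i := by
  have hemp : ENNReal.ofReal (empiricalLoss D f h) =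
      ∑ i ∈ occupied A D, (m : ℝ≥0∞)⁻¹ * ∑ j ∈ samplesIn A D i, ENNReal.ofReal (f h (D j)) := by
    rw [← Finset.mul_sum, hA.sum_samplesIn, empiricalLoss, ENNReal.ofReal_mul (by positivity),
      ENNReal.ofReal_sum_of_nonneg fun j _ => hf _, one_div,
      ENNReal.ofReal_inv_of_pos (by exact_mod_cast hm), ENNReal.ofReal_natCast]
  rw [hemp, ← Finset.sum_add_distrib]
  refine Finset.sum_le_sum fun i hi => ?_
  have := mul_le_mul_right (cellCount_mul_lintegral_cond_le P hA D i (hL i hi)) (m : ℝ≥0∞)⁻¹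
  rw [mul_add] at this
  simpa only [div_eq_mul_inv, mul_assoc, mul_comm, mul_left_comm] using this

/-- A convex combination is controlled by the excess of the empirical weights on the cells that
carry them. -/
lemma sum_mul_le_of_weights {ι : Type*} [Fintype ι] {p c a : ι → ℝ} {C : ℝ}
    {T : Finset ι} (hp : ∀ i, 0 ≤ p i) (hp1 : ∑ i, p i = 1) (hc1 : ∑ i ∈ T, c i = 1)
    (ha0 : ∀ i, 0 ≤ a i) (haC : ∀ i, a i ≤ C) {e : ι → ℝ} (he : ∀ i, 0 ≤ e i)
    (hce : ∀ i, c i ≤ p i + e i) :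
    ∑ i, p i * a i ≤ ∑ i ∈ T, c i * a i + C * ∑ i ∈ T, e i := by
  classical
  have hsplit : ∀ φ : ι → ℝ, ∑ i, φ i = ∑ i ∈ T, φ i + ∑ i ∈ Tᶜ, φ i := fun φ =>
    (Finset.sum_add_sum_compl T φ).symm
  -- Both weights total 1, so the `p`-mass off `T` is the excess of `c` over `p` on `T`.
  have h1 : ∑ i ∈ Tᶜ, p i * a i ≤ C * (∑ i ∈ T, c i - ∑ i ∈ T, p i) := by
    rw [hc1, ← hp1, hsplit p, add_sub_cancel_left, Finset.mul_sum]
    refine Finset.sum_le_sum fun i _ => ?_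
    rw [mul_comm C]
    exact mul_le_mul_of_nonneg_left (haC i) (hp i)
  -- Since `C - a i ≥ 0`, no lower bound on `c i - p i` is needed.
  have h2 : ∑ i ∈ T, (C - a i) * (c i - p i) ≤ ∑ i ∈ T, C * e i := by
    refine Finset.sum_le_sum fun i _ => ?_
    calc (C - a i) * (c i - p i) ≤ (C - a i) * e i :=
          mul_le_mul_of_nonneg_left (by linarith [hce i]) (by linarith [haC i])
      _ ≤ C * e i := mul_le_mul_of_nonneg_right (by linarith [ha0 i]) (he i)
  have h3 : ∑ i ∈ T, (C - a i) * (c i - p i) = C * (∑ i ∈ T, c i - ∑ i ∈ T, p i) -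
      ∑ i ∈ T, c i * a i + ∑ i ∈ T, p i * a i := by
    rw [← Finset.sum_sub_distrib, Finset.mul_sum, ← Finset.sum_sub_distrib,
      ← Finset.sum_add_distrib]
    exact Finset.sum_congr rfl fun i _ => by ring
  rw [hsplit, Finset.mul_sum]
  linarith

lemma sum_sqrt_le_sqrt_card {ι : Type*} {T : Finset ι} {p : ι → ℝ} (hp : ∀ i, 0 ≤ p i)
    (hp1 : ∑ i ∈ T, p i ≤ 1) : ∑ i ∈ T, √(p i) ≤ √(T.card : ℝ) := by
  refine Real.le_sqrt_of_sq_le ?_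
  calc (∑ i ∈ T, √(p i)) ^ 2 ≤ T.card * ∑ i ∈ T, √(p i) ^ 2 := sq_sum_le_card_mul_sum_sq
    _ = T.card * ∑ i ∈ T, p i := by simp only [Real.sq_sqrt (hp _)]
    _ ≤ T.card := mul_le_of_le_one_right (by positivity) hp1

/-- The generalization bound holds for every sample whose cell counts do not exceed their means too
much. -/
lemma expectedLoss_le_of_cellCount_le (hm : 0 < m) (P : Measure 𝒳) [IsProbabilityMeasure P]
    {H : Type*} {f : H → 𝒳 → ℝ} {h : H} (hf_meas : Measurable (f h)) (hf : ∀ x, 0 ≤ f h x)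
    (hf_bdd : BddAbove (Set.range (f h))) {A : Fin N → Set 𝒳} (hA : IsCellPartition A)
    (D : Fin m → 𝒳) {δ : ℝ} (hl : 0 < Real.log (2 * N / δ))
    (hcount : ∀ i, (cellCount A D i : ℝ) ≤ m * P.real (A i) +
      2 * √(m * P.real (A i) * Real.log (2 * N / δ)) + 2 * Real.log (2 * N / δ))
    {L : Fin N → ℝ≥0} (hL : ∀ i ∈ occupied A D, LipschitzOnWith (L i) (f h) (A i)) :
    (expectedLoss P f h : EReal) ≤ (empiricalLoss D f h : EReal) +
      ((∑ i ∈ occupied A D, (cellCount A D i : ℝ≥0∞) / (m : ℝ≥0∞) * avgDist P A D i *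
        (L i : ℝ≥0∞) : ℝ≥0∞) : EReal) + (gTerm f h A D δ : EReal) := by
  have hlip := sum_freq_mul_lintegral_cond_le hm P hf hA D hL
  set S : ℝ≥0∞ := ∑ i ∈ occupied A D, (cellCount A D i : ℝ≥0∞) / (m : ℝ≥0∞) * avgDist P A D i *
    (L i : ℝ≥0∞)
  -- An infinite Lipschitz term makes the bound trivial; otherwise everything is real.
  rcases eq_or_ne S ⊤ with hS | hS
  · rw [hS, EReal.coe_ennreal_top, EReal.coe_add_top, EReal.top_add_coe]
    exact le_top
  have hC : ∀ x, f h x ≤ supLoss f h := le_ciSup hf_bdd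
  have hint : ∀ ν : Measure 𝒳, IsFiniteMeasure ν → Integrable (f h) ν := fun ν _ =>
    Integrable.of_bound hf_meas.aestronglyMeasurable (supLoss f h) (ae_of_all _ fun x => by
      rw [Real.norm_eq_abs, abs_of_nonneg (hf x)]; exact hC x)
  have : Nonempty 𝒳 := nonempty_of_isProbabilityMeasure P
  have hC0 : 0 ≤ supLoss f h := (hf (Classical.arbitrary 𝒳)).trans (hC _)
  have hm' : (0 : ℝ) < m := by exact_mod_cast hm
  set l := Real.log (2 * N / δ) with hldef
  set a : Fin N → ℝ := fun i => ∫ x, f h x ∂P[|A i]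
  set p : Fin N → ℝ := fun i => P.real (A i)
  set c : Fin N → ℝ := fun i => cellCount A D i / m
  have ha0 : ∀ i, 0 ≤ a i := fun i => integral_nonneg hf
  have haC : ∀ i, a i ≤ supLoss f h := fun i => by
    calc a i ≤ ∫ _x, supLoss f h ∂P[|A i] :=
          integral_mono (hint _ inferInstance) (integrable_const _) hC
      _ = (P[|A i]).real Set.univ * supLoss f h := by simp
      _ ≤ supLoss f h := mul_le_of_le_one_left hC0 measureReal_le_one
  have hF : expectedLoss P f h = ∑ i, p i * a i :=
    hA.integral_eq_sum_cond P (hint P inferInstance)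
  have hreal : ∑ i ∈ occupied A D, c i * a i ≤ empiricalLoss D f h + S.toReal := by
    have hemp : 0 ≤ empiricalLoss D f h :=
      mul_nonneg (by positivity) (Finset.sum_nonneg fun j _ => hf _)
    have hterm : ∀ i, (cellCount A D i : ℝ≥0∞) / m * ∫⁻ x, ENNReal.ofReal (f h x) ∂P[|A i] =
        ENNReal.ofReal (c i * a i) := fun i => by
      rw [ENNReal.ofReal_mul (by positivity), ENNReal.ofReal_div_of_pos hm',
        ENNReal.ofReal_natCast, ENNReal.ofReal_natCast,
        ofReal_integral_eq_lintegral_ofReal (hint _ inferInstance) (ae_of_all _ hf)]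
    simp only [hterm] at hlip
    rw [← ENNReal.ofReal_sum_of_nonneg fun i _ => mul_nonneg (by positivity) (ha0 i),
      ← ENNReal.ofReal_toReal hS, ← ENNReal.ofReal_add hemp ENNReal.toReal_nonneg] at hlip
    exact (ENNReal.ofReal_le_ofReal_iff (add_nonneg hemp ENNReal.toReal_nonneg)).1 hlip
  have hc1 : ∑ i ∈ occupied A D, c i = 1 := by
    rw [← Finset.sum_div, ← Nat.cast_sum, hA.sum_cellCount, div_self hm'.ne']
  have hp0 : ∀ i, 0 ≤ p i := fun i => measureReal_nonneg
  set e : Fin N → ℝ := fun i => 2 * √(l / m) * √(p i) + 2 * l / m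
  have hce : ∀ i, c i ≤ p i + e i := fun i => by
    have hsq : √(m * p i * l) = m * (√(l / m) * √(p i)) := by
      rw [← Real.sqrt_mul (by positivity), Real.sqrt_eq_iff_mul_self_eq
        (mul_nonneg (mul_nonneg hm'.le (hp0 i)) hl.le) (by positivity), mul_mul_mul_comm,
        Real.mul_self_sqrt (mul_nonneg (by positivity) (hp0 i))]
      field_simp
    have := hcount i
    rw [hsq] at this
    rw [div_le_iff₀ hm']
    refine this.trans_eq ?_
    simp only [e, p]
    field_simp
    ring
  have hmain := sum_mul_le_of_weights hp0 (hA.sum_measureReal P) hc1 ha0 haC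
    (fun i => by positivity) hce
  have hpT : ∑ i ∈ occupied A D, p i ≤ 1 := by
    rw [← hA.sum_measureReal P]
    exact Finset.sum_le_sum_of_subset_of_nonneg (Finset.subset_univ _) fun i _ _ => hp0 i
  have hg : supLoss f h * ∑ i ∈ occupied A D, e i ≤ gTerm f h A D δ := by
    have hsum : ∑ i ∈ occupied A D, e i ≤ (√2 + 1) * √((occupied A D).card * l / m) +
        2 * (occupied A D).card * l / m := by
      -- This gives `2 ≤ √2 + 1`, absorbing the Chernoff constant into that of `gTerm`.
      have h2 : (1 : ℝ) ≤ √2 := Real.one_le_sqrt.2 one_le_two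
      simp only [e]
      rw [Finset.sum_add_distrib, ← Finset.mul_sum, Finset.sum_const, nsmul_eq_mul]
      refine add_le_add ?_ (le_of_eq (by ring))
      rw [mul_div_assoc, Real.sqrt_mul (by positivity), mul_comm √((occupied A D).card : ℝ),
        ← mul_assoc]
      exact mul_le_mul (mul_le_mul_of_nonneg_right (by linarith) (by positivity))
        (sum_sqrt_le_sqrt_card hp0 hpT) (Finset.sum_nonneg fun i _ => by positivity)
        (by positivity)
    refine (mul_le_mul_of_nonneg_left hsum hC0).trans_eq ?_
    rw [gTerm, ← hldef]
    ring
  have hfinal : expectedLoss P f h ≤ empiricalLoss D f h + S.toReal + gTerm f h A D δ := by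
    rw [hF]; linarith
  rw [← EReal.coe_ennreal_toReal hS]
  exact_mod_cast hfinal

end Deterministic

end LocalLipschitz

/-! ### Union bound over the cells. -/

theorem mainTheorem6 {d m N : ℕ} (hm : 0 < m)
    -- the data space, the data distribution, the loss and the model
    (𝒳 : Set (Fin d → ℝ)) (P : Measure 𝒳) [IsProbabilityMeasure P]
    {H : Type*} (f : H → 𝒳 → ℝ) (h : H)
    (hf_meas : Measurable (f h)) (hf_nonneg : ∀ x, 0 ≤ f h x)
    (hf_bdd : BddAbove (Set.range (f h)))
    -- the partition of the data space
    (A : Fin N → Set 𝒳) (hA : LocalLipschitz.IsCellPartition A)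
    -- the dataset: `m` i.i.d. samples from `P`
    {Ω : Type*} [MeasurableSpace Ω] (μ : Measure Ω) [IsProbabilityMeasure μ]
    (D : Fin m → Ω → 𝒳) (hD_meas : ∀ j, Measurable (D j))
    (hD_indep : iIndepFun D μ) (hD_law : ∀ j, μ.map (D j) = P)
    (δ : ℝ) (hδ : 0 < δ) :
    ENNReal.ofReal (1 - δ) ≤
      μ {ω | ∀ L : Fin N → ℝ≥0,
        (∀ i ∈ LocalLipschitz.occupied A (fun j => D j ω), LipschitzOnWith (L i) (f h) (A i)) →
        (LocalLipschitz.expectedLoss P f h : EReal) ≤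
          (LocalLipschitz.empiricalLoss (fun j => D j ω) f h : EReal) +
          ((∑ i ∈ LocalLipschitz.occupied A (fun j => D j ω),
              (LocalLipschitz.cellCount A (fun j => D j ω) i : ℝ≥0∞) / (m : ℝ≥0∞) *
                LocalLipschitz.avgDist P A (fun j => D j ω) i * (L i : ℝ≥0∞) : ℝ≥0∞) : EReal) +
          (LocalLipschitz.gTerm f h A (fun j => D j ω) δ : EReal)} := by
  rcases le_or_gt 1 δ with h1 | h1
  · rw [ENNReal.ofReal_of_nonpos (by linarith)]
    exact zero_le
  have hN : 0 < N := by
    obtain ⟨x⟩ := nonempty_of_isProbabilityMeasure P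
    obtain ⟨i, -⟩ := Set.mem_iUnion.1 (hA.iUnion_eq ▸ Set.mem_univ x)
    exact i.pos
  have hN' : (1 : ℝ) ≤ N := by exact_mod_cast hN
  have hl : 0 < Real.log (2 * N / δ) :=
    Real.log_pos ((one_lt_div hδ).2 (by linarith))
  set bad : Fin N → Set Ω := fun i => {ω | m * P.real (A i) +
    2 * √(m * P.real (A i) * Real.log (2 * N / δ)) + 2 * Real.log (2 * N / δ) ≤
      ∑ j, (A i).indicator (fun _ => (1 : ℝ)) (D j ω)} with hbad_def
  have hbad : ∀ i, μ.real (bad i) ≤ δ / (2 * N) := fun i => by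
    refine (LocalLipschitz.measureReal_sum_indicator_ge_le hD_meas hD_indep hD_law
      (hA.measurableSet i) hl).trans_eq ?_
    -- With `l = ln(2N/δ)` the `N` bad events together cost only `δ/2`.
    rw [Real.exp_neg, Real.exp_log (by positivity), inv_div]
  have hunion : μ.real (⋃ i, bad i) ≤ δ := by
    calc μ.real (⋃ i, bad i) ≤ ∑ i, μ.real (bad i) := measureReal_iUnion_fintype_le _
      _ ≤ ∑ _i : Fin N, δ / (2 * N) := Finset.sum_le_sum fun i _ => hbad i
      _ = δ / 2 := by
        rw [Finset.sum_const, Finset.card_univ, Fintype.card_fin, nsmul_eq_mul]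
        field_simp
      _ ≤ δ := by linarith
  have hcompl : 1 - δ ≤ μ.real (⋃ i, bad i)ᶜ := by
    have := measureReal_union_le (μ := μ) (⋃ i, bad i) (⋃ i, bad i)ᶜ
    rw [Set.union_compl_self, probReal_univ] at this
    linarith
  -- The bad events do not involve `L`, so one good event serves all `L` at once; monotonicity needs
  -- no measurability of the target event.
  refine (ENNReal.ofReal_le_of_le_toReal hcompl).trans (measure_mono fun ω hω L hL => ?_)
  refine LocalLipschitz.expectedLoss_le_of_cellCount_le hm P hf_meas hf_nonneg hf_bdd hA
    (fun j => D j ω) hl (fun i => ?_) hL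
  have hi : ω ∉ bad i := fun hi => hω (Set.mem_iUnion.2 ⟨i, hi⟩)
  rw [LocalLipschitz.cellCount_eq_sum_indicator]
  exact (not_le.1 hi).le
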